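/- \textbf{Definitions.} Finitely generated groups are endowed with the word metric of a finite generating set. A central extension $1\to Z\to E\xrightarrow{\pi} G\to 1$ of a finitely generated group $G$ by a finitely generated abelian group $Z$ is \emph{quasi-isometrically trivial} if there is a quasi-isometry $f\colon E\to Z\times G$ such that $\pi_2\circ f$ is at bounded distance from $\pi$, where $\pi_2\colon Z\times G\to G$ is the projection. Its \emph{Euler class} is the class in $H^2(G,Z)$ of the cocycle $(g,h)\mapsto s(g)s(h)s(gh)^{-1}\in Z$, where $s\colon G\to E$ is any set-theoretic section of $\pi$; a class in $H^2(G,Z)$ is \emph{bounded} if it is represented by a bounded (equivalently, finite-valued) cocycle. A finitely generated group $G$ \emph{satisfies Property QITB} if, for every finitely generated abelian group $Z$, the Euler class of every quasi-isometrically trivial central extension of $G$ by $Z$ is bounded. \textbf{Proposition.} Let $G=G_1*_H G_2$ be the amalgamated product defined by injective homomorphisms $i_1\colon H\to G_1$ and $i_2\colon H\to G_2$. Assume that it is \emph{transverse}, i.e. that the map $$(i_1)_*\oplus(i_2)_*\colon H_1(H,\mathbb{R})\to H_1(G_1,\mathbb{R})\oplus H_1(G_2,\mathbb{R})$$ is injective,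 and that $H$ is amenable. If the finitely generated groups $G_1$ and $G_2$ satisfy Property QITB, then $G$ (which is finitely generated) satisfies Property QITB. -/

import Mathlib

universe u v

noncomputable section

/-! ### Word metrics and quasi-isometries -/

/-- The word length of `g` with respect to `S`: the minimal number of factors needed to write `g`
as a product of elements of `S` and their inverses (meaningful when `S` generates the group). -/
def wordLength {G : Type*} [Group G] (S : Set G) (g : G) : ℕ :=
  sInf {n : ℕ | ∃ l : List G, (∀ x ∈ l, x ∈ S ∨ x⁻¹ ∈ S) ∧ l.prod = g ∧ l.length = n}

/-- The distance between `g` and `h` in the Cayley graph of `G` with respect to `S`, whose edges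
join `g` with `g * s` for `s ∈ S`. -/
def wordDist {G : Type*} [Group G] (S : Set G) (g h : G) : ℝ :=
  wordLength S (g⁻¹ * h)

/-- `f` is a quasi-isometric embedding from the distance `d` to the distance `d'`. -/
def IsQIEmbedding {X Y : Type*} (d : X → X → ℝ) (d' : Y → Y → ℝ) (f : X → Y) : Prop :=
  ∃ k c : ℝ, 1 ≤ k ∧ 0 ≤ c ∧
    ∀ x₁ x₂, d x₁ x₂ / k - c ≤ d' (f x₁) (f x₂) ∧ d' (f x₁) (f x₂) ≤ k * d x₁ x₂ + c

/-- `f` is a quasi-isometry: a quasi-isometric embedding that admits a quasi-inverse. -/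
def IsQuasiIsometry {X Y : Type*} (d : X → X → ℝ) (d' : Y → Y → ℝ) (f : X → Y) : Prop :=
  IsQIEmbedding d d' f ∧
    ∃ g : Y → X, IsQIEmbedding d' d g ∧
      (∃ C : ℝ, ∀ x, d (g (f x)) x ≤ C) ∧ ∃ C : ℝ, ∀ y, d' (f (g y)) y ≤ C

/-! ### Central extensions and their Euler classes -/

namespace GroupExtension

/-- The extension `1 → Z → E → G → 1` is central. -/
def IsCentral {Z E G : Type*} [Group Z] [Group E] [Group G] (S : GroupExtension Z E G) : Prop :=
  ∀ z : Z, S.inl z ∈ Subgroup.center E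

/-- The extension `1 → Z → E → G → 1` is quasi-isometrically trivial: with respect to word metrics
of finite generating sets, there is a quasi-isometry `f : E → Z × G` such that `π₂ ∘ f` is at
bounded distance from the projection `E → G`. The choice of the finite generating sets is
immaterial. -/
def IsQITrivial {Z E G : Type*} [Group Z] [Group E] [Group G] (S : GroupExtension Z E G) : Prop :=
  ∃ (A : Finset E) (B : Finset (Z × G)) (C : Finset G),
    Subgroup.closure (A : Set E) = ⊤ ∧ Subgroup.closure (B : Set (Z × G)) = ⊤ ∧
    Subgroup.closure (C : Set G) = ⊤ ∧
    ∃ f : E → Z × G, IsQuasiIsometry (wordDist (A : Set E)) (wordDist (B : Set (Z × G))) f ∧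
      ∃ K : ℝ, ∀ e : E, wordDist (C : Set G) (S.rightHom e) (f e).2 ≤ K

section Euler

variable {Z E G : Type*} [Group Z] [Group E] [Group G] (S : GroupExtension Z E G)

theorem exists_inl_eq_section (s : S.Section) (g h : G) :
    ∃ z : Z, S.inl z = s g * s h * (s (g * h))⁻¹ := by
  have : s g * s h * (s (g * h))⁻¹ ∈ S.inl.range := by
    rw [S.range_inl_eq_ker_rightHom, MonoidHom.mem_ker]
    simp
  exact this

/-- The cochain `ω_s(g, h) = s(g) s(h) s(gh)⁻¹ ∈ Z` associated with a section `s`. -/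
def sectionCochain (s : S.Section) (p : G × G) : Z :=
  (S.exists_inl_eq_section s p.1 p.2).choose

theorem inl_sectionCochain (s : S.Section) (g h : G) :
    S.inl (S.sectionCochain s (g, h)) = s g * s h * (s (g * h))⁻¹ :=
  (S.exists_inl_eq_section s g h).choose_spec

theorem sectionCochain_mul (hS : S.IsCentral) (s : S.Section) (g h j : G) :
    S.sectionCochain s (g * h, j) * S.sectionCochain s (g, h) =
      S.sectionCochain s (h, j) * S.sectionCochain s (g, h * j) := by
  apply S.inl_injective
  have c := fun z e => (Subgroup.mem_center_iff.1 (hS z) e)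
  rw [map_mul, ← c, map_mul, inl_sectionCochain S s g h, inl_sectionCochain S s g (h * j),
    inl_sectionCochain S s (g * h) j]
  have h1 : S.inl (S.sectionCochain s (h, j)) * s g = s g * (s h * s j * (s (h * j))⁻¹) := by
    rw [← c, inl_sectionCochain]
  have h2 : S.inl (S.sectionCochain s (h, j)) * (s g * s (h * j) * (s (g * (h * j)))⁻¹) =
      (S.inl (S.sectionCochain s (h, j)) * s g) * s (h * j) * (s (g * (h * j)))⁻¹ := by
    group
  rw [h2, h1, mul_assoc g h j]
  group

/-- A set-theoretic section, which exists because the projection is surjective. -/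
def someSection : S.Section :=
  ⟨Function.surjInv S.rightHom_surjective, Function.rightInverse_surjInv S.rightHom_surjective⟩

end Euler

/-- The cocycle `ω_s` as an inhomogeneous `2`-cocycle of `G` with values in the trivial
`G`-module `Z`. -/
def sectionCocycle {Z E G : Type} [CommGroup Z] [Group E] [Group G] (S : GroupExtension Z E G)
    (hS : S.IsCentral) (s : S.Section) :
    groupCohomology.cocycles₂ (Rep.trivial ℤ G (Additive Z)) :=
  ⟨fun p => Additive.ofMul (S.sectionCochain s p : Z),
    (groupCohomology.mem_cocycles₂_iff (A := Rep.trivial ℤ G (Additive Z)) _).2 fun g h j =>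
      congrArg Additive.ofMul (S.sectionCochain_mul hS s g h j)⟩

/-- The Euler class in `H²(G, Z)` of a central extension `1 → Z → E → G → 1`. -/
def eulerClass {Z E G : Type} [CommGroup Z] [Group E] [Group G] (S : GroupExtension Z E G)
    (hS : S.IsCentral) : groupCohomology.H2 (Rep.trivial ℤ G (Additive Z)) :=
  groupCohomology.H2π _ (S.sectionCocycle hS S.someSection)

/-- The Euler class may be computed from any section. -/
theorem eulerClass_eq {Z E G : Type} [CommGroup Z] [Group E] [Group G] (S : GroupExtension Z E G)
    (hS : S.IsCentral) (s : S.Section) :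
    S.eulerClass hS = groupCohomology.H2π _ (S.sectionCocycle hS s) := by
  have hz : ∀ g, ∃ z : Z, S.inl z = S.someSection g * (s g)⁻¹ := fun g => by
    have : S.someSection g * (s g)⁻¹ ∈ S.inl.range := by
      rw [S.range_inl_eq_ker_rightHom, MonoidHom.mem_ker]
      simp
    exact this
  choose z hz using hz
  refine (groupCohomology.H2π_eq_iff _ _).2 ⟨fun g => Additive.ofMul (z g : Z), ?_⟩
  funext p
  obtain ⟨g, h⟩ := p
  change Additive.ofMul (z h / z (g * h) * z g) =
    Additive.ofMul (S.sectionCochain S.someSection (g, h) / S.sectionCochain s (g, h))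
  congr 1
  rw [div_mul_eq_mul_div, eq_comm, div_eq_div_iff_mul_eq_mul]
  apply S.inl_injective
  have c := fun z e => (Subgroup.mem_center_iff.1 (hS z) e)
  have hs : ∀ g, S.someSection g = S.inl (z g) * s g := fun g => by rw [hz]; group
  simp only [map_mul, inl_sectionCochain, hs]
  have c1 := c (z h) (S.inl (z g) * s g)
  rw [← mul_assoc (S.inl (z g) * s g), c1]
  group

end GroupExtension

/-- A class in `H²(G, A)`, with `A` a finitely generated abelian group, is bounded if it is
represented by a bounded cocycle. A subset of `A` is bounded if and only if it is finite. -/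
def IsBoundedClass {G A : Type} [Group G] [AddCommGroup A]
    (α : groupCohomology.H2 (Rep.trivial ℤ G A)) : Prop :=
  ∃ ω : groupCohomology.cocycles₂ (Rep.trivial ℤ G A),
    groupCohomology.H2π _ ω = α ∧ (Set.range (fun p : G × G => (ω p : A))).Finite

/-- Property QITB for a finitely generated group `G`: for every finitely generated abelian group
`Z`, the Euler class of any quasi-isometrically trivial central extension of `G` by `Z` is
bounded. -/
def PropertyQITB (G : Type) [Group G] : Prop :=
  Group.FG G ∧
    ∀ (Z E : Type) [CommGroup Z] [Group E] (S : GroupExtension Z E G) (hS : S.IsCentral),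
      Group.FG Z → S.IsQITrivial → IsBoundedClass (S.eulerClass hS)

/-! ### Amenable groups -/

/-- `G` is amenable: there is a right-invariant mean on the space `ℓ^∞(G, ℝ)` of bounded
functions. -/
def IsAmenableGroup (G : Type*) [Group G] : Prop :=
  ∃ m : lp (fun _ : G => ℝ) ⊤ →ₗ[ℝ] ℝ,
    (∀ f : lp (fun _ : G => ℝ) ⊤, (∀ x, 0 ≤ f x) → 0 ≤ m f) ∧
    m 1 = 1 ∧
    ∀ (g : G) (f f' : lp (fun _ : G => ℝ) ⊤), (∀ x, f' x = f (x * g)) → m f' = m f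

/-! ### Amalgamated products -/

/-- The two factors of an amalgamated product, as a family. -/
def amalgamFactor (G₁ G₂ : Type u) : Bool → Type u
  | false => G₁
  | true => G₂

instance amalgamFactor.instGroup (G₁ G₂ : Type u) [Group G₁] [Group G₂] :
    ∀ b, Group (amalgamFactor G₁ G₂ b)
  | false => inferInstanceAs (Group G₁)
  | true => inferInstanceAs (Group G₂)

/-- The two homomorphisms defining an amalgamated product, as a family. -/
def amalgamHom {H : Type v} {G₁ G₂ : Type u} [Group H] [Group G₁] [Group G₂] (i₁ : H →* G₁) (i₂ : H →* G₂) :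
    ∀ b, H →* amalgamFactor G₁ G₂ b
  | false => i₁
  | true => i₂

/-- The amalgamated product `G₁ *_H G₂`: the pushout of `i₁ : H → G₁` and `i₂ : H → G₂`. -/
abbrev AmalgamatedProduct {H : Type v} {G₁ G₂ : Type u} [Group H] [Group G₁] [Group G₂]
    (i₁ : H →* G₁) (i₂ : H →* G₂) : Type (max u v) :=
  Monoid.PushoutI (amalgamHom i₁ i₂)

/-- The identity of `ℝ` as a morphism from the trivial `G`-module `ℝ` to the restriction along
`f : G → K` of the trivial `K`-module `ℝ`. -/
def realCoeffHom {G K : Type} [Group G] [Group K] (f : G →* K) :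
    Rep.trivial ℝ G ℝ ⟶ Rep.res f (Rep.trivial ℝ K ℝ) :=
  Rep.ofHom ⟨LinearMap.id, fun _ => rfl⟩

/-- The map `H₁(f, ℝ) : H₁(G, ℝ) → H₁(K, ℝ)` induced by a homomorphism `f : G → K`. -/
def realH1Map {G K : Type} [Group G] [Group K] (f : G →* K) :
    groupHomology.H1 (Rep.trivial ℝ G ℝ) →ₗ[ℝ] groupHomology.H1 (Rep.trivial ℝ K ℝ) :=
  (groupHomology.map f (realCoeffHom f) 1).hom

/-- The amalgamated product defined by the inclusions `i₁ : H → G₁` and `i₂ : H → G₂` is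
transverse: `H₁(H, ℝ) → H₁(G₁, ℝ) ⊕ H₁(G₂, ℝ)` is injective. -/
def IsTransverse {H G₁ G₂ : Type} [Group H] [Group G₁] [Group G₂]
    (i₁ : H →* G₁) (i₂ : H →* G₂) : Prop :=
  Function.Injective ((realH1Map i₁).prod (realH1Map i₂))

end

/-! Quasi-isometric triviality amounts to the existence of a section `s` for which `s(g)⁻¹ s(gh)`
takes finitely many values for each fixed `h`. Such a section pulls back along any homomorphism, so
Property QITB of the two factors bounds the restrictions of its cocycle to them, up to coboundaries.
Since `Z` is `ℤⁿ` times a finite group, it remains to show, for each homomorphism `p : Z → ℝ`, that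
the image of the cocycle under `p` is at bounded distance from a real coboundary on the amalgam
(`isBoundedClass_eulerClass_of_real`).

Work in `E`, with `A b` the preimages of the factors and `C` that of `H`. The primitives on the
factors give quasimorphisms on the `A b` extending `p`; a quasimorphism on `E` extending `p` up to
bounded error, composed with `s`, is the primitive sought. As `H = C / Z` is amenable, each given
quasimorphism is close on `C` to a homomorphism extending `p` (`exists_hom_near`). The difference of
the two homomorphisms descends to `H`, and transversality writes it as a difference of restrictions
of homomorphisms of the factors. After this correction both quasimorphisms are close to the same
homomorphism on `C`. Averaging makes them odd and exactly equivariant under `C` on both sides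
(`exists_biequivariant`), and summing over the letters of reduced words then defines a quasimorphism
on `E` (`exists_quasimorphism`). -/

/-! ### Word metrics: balls are finite, so bounded displacement means finitely many displacements.
-/

section WordMetric

variable {X Y : Type*} [Group X] [Group Y]

theorem exists_word_of_closure_eq_top {S : Set X} (hS : Subgroup.closure S = ⊤) (g : X) :
    ∃ l : List X, (∀ x ∈ l, x ∈ S ∨ x⁻¹ ∈ S) ∧ l.prod = g ∧ l.length = wordLength S g := by
  have hne : {n : ℕ | ∃ l : List X, (∀ x ∈ l, x ∈ S ∨ x⁻¹ ∈ S) ∧ l.prod = g ∧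
      l.length = n}.Nonempty := by
    have hg : g ∈ (Subgroup.closure S).toSubmonoid := hS ▸ Subgroup.mem_top g
    rw [Subgroup.closure_toSubmonoid] at hg
    obtain ⟨l, hl, rfl⟩ := Submonoid.exists_list_of_mem_closure hg
    exact ⟨_, l, hl, rfl, rfl⟩
  exact Nat.sInf_mem hne

theorem wordLength_prod_le {S : Set X} (l : List X) (hl : ∀ x ∈ l, x ∈ S ∨ x⁻¹ ∈ S) :
    wordLength S l.prod ≤ l.length :=
  Nat.sInf_le ⟨l, hl, rfl, rfl⟩

theorem wordLength_mul_le {S : Set X} (hS : Subgroup.closure S = ⊤) (g h : X) :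
    wordLength S (g * h) ≤ wordLength S g + wordLength S h := by
  obtain ⟨l, hl, hlg, hln⟩ := exists_word_of_closure_eq_top hS g
  obtain ⟨m, hm, hmh, hmn⟩ := exists_word_of_closure_eq_top hS h
  rw [← hln, ← hmn, ← List.length_append, ← hlg, ← hmh, ← List.prod_append]
  refine wordLength_prod_le _ fun x hx => ?_
  rcases List.mem_append.1 hx with h | h
  exacts [hl x h, hm x h]

theorem wordLength_one (S : Set X) : wordLength S 1 = 0 :=
  Nat.le_zero.1 (wordLength_prod_le (S := S) [] (by simp))

theorem finite_setOf_wordLength_le {S : Set X} (hfin : S.Finite)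
    (hS : Subgroup.closure S = ⊤) (n : ℕ) : {g : X | wordLength S g ≤ n}.Finite := by
  have hT : (S ∪ S⁻¹).Finite := hfin.union hfin.inv
  have : Finite ↥(S ∪ S⁻¹) := hT
  have hL : {l : List ↥(S ∪ S⁻¹) | l.length ≤ n}.Finite := List.finite_length_le _ n
  refine (hL.image fun l => (l.map Subtype.val).prod).subset fun g hg => ?_
  obtain ⟨l, hl, hlg, hln⟩ := exists_word_of_closure_eq_top hS g
  refine ⟨l.attach.map fun x => ⟨x.1, ?_⟩, ?_, ?_⟩
  · rcases hl x.1 x.2 with h | h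
    exacts [Or.inl h, Or.inr h]
  · simpa [hln] using hg
  · simp [List.map_map, Function.comp_def, hlg]

/-- A map which moves along right multiplication by each fixed element in only finitely many ways
is Lipschitz for the word metrics. -/
theorem exists_wordDist_le_mul {A : Set X} {B : Set Y} (hAfin : A.Finite)
    (hA : Subgroup.closure A = ⊤) (hB : Subgroup.closure B = ⊤) (f : X → Y)
    (hf : ∀ a, (Set.range fun e => (f e)⁻¹ * f (e * a)).Finite) :
    ∃ k : ℝ, 1 ≤ k ∧ ∀ e e', wordDist B (f e) (f e') ≤ k * wordDist A e e' := by
  have hT : (⋃ a ∈ A ∪ A⁻¹, Set.range fun e => (f e)⁻¹ * f (e * a)).Finite :=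
    (hAfin.union hAfin.inv).biUnion fun a _ => hf a
  obtain ⟨N, hN⟩ := (hT.image (wordLength B)).bddAbove
  have hN' : ∀ a, a ∈ A ∨ a⁻¹ ∈ A → ∀ e, wordLength B ((f e)⁻¹ * f (e * a)) ≤ N :=
    fun a ha e => hN ⟨_, Set.mem_biUnion (show a ∈ A ∪ A⁻¹ from ha) ⟨e, rfl⟩, rfl⟩
  have key : ∀ l : List X, (∀ x ∈ l, x ∈ A ∨ x⁻¹ ∈ A) → ∀ e,
      wordLength B ((f e)⁻¹ * f (e * l.prod)) ≤ N * l.length := by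
    intro l
    induction l with
    | nil => intro _ e; simp [wordLength_one]
    | cons a l ih =>
      intro hl e
      have h1 := hN' a (hl a (by simp)) e
      have h2 := ih (fun x hx => hl x (by simp [hx])) (e * a)
      have h3 := wordLength_mul_le hB ((f e)⁻¹ * f (e * a))
        ((f (e * a))⁻¹ * f (e * a * l.prod))
      have h4 : (f e)⁻¹ * f (e * a) * ((f (e * a))⁻¹ * f (e * a * l.prod)) =
          (f e)⁻¹ * f (e * (a :: l).prod) := by
        simp [mul_assoc]
      rw [h4] at h3
      rw [List.length_cons, Nat.mul_succ]
      omega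
  refine ⟨N + 1, by simp, fun e e' => ?_⟩
  obtain ⟨l, hl, hlg, hln⟩ := exists_word_of_closure_eq_top hA (e⁻¹ * e')
  have h := key l hl e
  rw [hlg, mul_inv_cancel_left, hln] at h
  unfold wordDist
  have h' : (wordLength B ((f e)⁻¹ * f e') : ℝ) ≤ N * wordLength A (e⁻¹ * e') := by
    exact_mod_cast h
  nlinarith [Nat.cast_nonneg (α := ℝ) (wordLength A (e⁻¹ * e'))]

/-- A bijection which, like its inverse, moves along right multiplication by each fixed element in
only finitely many ways is a quasi-isometry for the word metrics. -/
theorem isQuasiIsometry_of_equiv {A : Set X} {B : Set Y} (hAfin : A.Finite) (hBfin : B.Finite)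
    (hA : Subgroup.closure A = ⊤) (hB : Subgroup.closure B = ⊤) (f : X ≃ Y)
    (hf : ∀ a, (Set.range fun e => (f e)⁻¹ * f (e * a)).Finite)
    (hf' : ∀ a, (Set.range fun e => (f.symm e)⁻¹ * f.symm (e * a)).Finite) :
    IsQuasiIsometry (wordDist A) (wordDist B) f := by
  obtain ⟨k, hk, hkf⟩ := exists_wordDist_le_mul hAfin hA hB f hf
  obtain ⟨k', hk', hkf'⟩ := exists_wordDist_le_mul hBfin hB hA f.symm hf'
  have nnA : ∀ x y, 0 ≤ wordDist A x y := fun _ _ => Nat.cast_nonneg _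
  have nnB : ∀ x y, 0 ≤ wordDist B x y := fun _ _ => Nat.cast_nonneg _
  refine ⟨⟨max k k', 0, le_max_of_le_left hk, le_rfl, fun x y => ⟨?_, ?_⟩⟩,
    f.symm, ⟨max k k', 0, le_max_of_le_left hk, le_rfl, fun x y => ⟨?_, ?_⟩⟩,
    ⟨0, fun x => ?_⟩, ⟨0, fun x => ?_⟩⟩
  · rw [sub_zero, div_le_iff₀ (by positivity), mul_comm]
    have := hkf' (f x) (f y)
    simp only [Equiv.symm_apply_apply] at this
    exact this.trans (mul_le_mul_of_nonneg_right (le_max_right _ _) (nnB _ _))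
  · rw [add_zero]
    exact (hkf x y).trans (mul_le_mul_of_nonneg_right (le_max_left _ _) (nnA _ _))
  · rw [sub_zero, div_le_iff₀ (by positivity), mul_comm]
    have := hkf (f.symm x) (f.symm y)
    simp only [Equiv.apply_symm_apply] at this
    exact this.trans (mul_le_mul_of_nonneg_right (le_max_left _ _) (nnA _ _))
  · rw [add_zero]
    exact (hkf' x y).trans (mul_le_mul_of_nonneg_right (le_max_right _ _) (nnB _ _))
  · simp [wordDist, wordLength_one]
  · simp [wordDist, wordLength_one]

/-- The bridge from metric to combinatorial statements: afterwards every bounded distance is handled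
as a finite range, and no constants are tracked. -/
theorem finite_setOf_wordDist_le {ι : Type*} {S : Set X} (hfin : S.Finite)
    (hS : Subgroup.closure S = ⊤) {u v : ι → X} {r : ℝ} (h : ∀ i, wordDist S (u i) (v i) ≤ r) :
    (Set.range fun i => (u i)⁻¹ * v i).Finite := by
  refine (finite_setOf_wordLength_le hfin hS ⌊r⌋₊).subset ?_
  rintro _ ⟨i, rfl⟩
  exact Nat.le_floor (h i)

end WordMetric

theorem Set.Finite.range_mul {ι M : Type*} [Mul M] {u v : ι → M} (hu : (Set.range u).Finite)
    (hv : (Set.range v).Finite) : (Set.range fun i => u i * v i).Finite := by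
  refine (hu.mul hv).subset ?_
  rintro _ ⟨i, rfl⟩
  exact Set.mul_mem_mul ⟨i, rfl⟩ ⟨i, rfl⟩

theorem Set.Finite.range_comp_fun {ι α β : Type*} {u : ι → α} (hu : (Set.range u).Finite)
    (f : α → β) : (Set.range fun i => f (u i)).Finite := by
  refine (hu.image f).subset ?_
  rintro _ ⟨i, rfl⟩
  exact ⟨_, ⟨i, rfl⟩, rfl⟩

theorem Set.Finite.range_comp_right {ι κ α : Type*} {u : ι → α} (hu : (Set.range u).Finite)
    (f : κ → ι) : (Set.range fun i => u (f i)).Finite :=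
  hu.subset (Set.range_comp_subset_range f u)

/-! ### Quasi-isometric triviality in terms of sections. -/

namespace GroupExtension

variable {Z E G : Type*} [Group Z] [Group E] [Group G] (S : GroupExtension Z E G)

/-- A section `s` is coarsely Lipschitz if `s(g)⁻¹ s(gh)` takes finitely many values for every
fixed `h`. -/
def Section.IsCoarselyLipschitz {S : GroupExtension Z E G} (s : S.Section) : Prop :=
  ∀ h, (Set.range fun g => (s g)⁻¹ * s (g * h)).Finite

/-- A quasi-inverse restricted to `{1} × G` is a coarse section. Its projection to `G` differs from
the identity by finitely many elements, and correcting by lifts of these gives a true section. -/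
theorem IsQITrivial.exists_section (hS : S.IsQITrivial) :
    ∃ s : S.Section, s.IsCoarselyLipschitz := by
  obtain ⟨A, B, C, hA, hB, hC, f, ⟨-, q, ⟨k, c, -, -, hq⟩, -, b, hb⟩, K, hK⟩ := hS
  let σ : G → E := fun g => q (1, g)
  have hσ : ∀ h, (Set.range fun g => (σ g)⁻¹ * σ (g * h)).Finite := by
    intro h
    refine finite_setOf_wordDist_le A.finite_toSet hA
      (r := k * wordLength (B : Set (Z × G)) (1, h) + c) fun g => ?_
    refine (hq _ _).2.trans (le_of_eq ?_)
    simp [wordDist]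
  have hπ : (Set.range fun g => (S.rightHom (σ g))⁻¹ * g).Finite := by
    have h1 : (Set.range fun g => (S.rightHom (σ g))⁻¹ * (f (σ g)).2).Finite :=
      finite_setOf_wordDist_le C.finite_toSet hC fun g => hK (σ g)
    have h2 : (Set.range fun g => (f (σ g))⁻¹ * (1, g)).Finite :=
      finite_setOf_wordDist_le B.finite_toSet hB fun g => hb (1, g)
    refine (h1.range_mul (h2.range_comp_fun Prod.snd)).subset ?_
    rintro _ ⟨g, rfl⟩
    exact ⟨g, by simp [mul_assoc]⟩
  let t := S.someSection
  refine ⟨⟨fun g => σ g * t ((S.rightHom (σ g))⁻¹ * g), fun g => ?_⟩, fun h => ?_⟩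
  · simp
  · have h1 := (hπ.range_comp_fun t)
    refine (((h1.range_comp_fun (·⁻¹)).range_mul (hσ h)).range_mul
      (h1.range_comp_right (· * h))).subset ?_
    rintro _ ⟨g, rfl⟩
    refine ⟨g, ?_⟩
    change _ = (σ g * t ((S.rightHom (σ g))⁻¹ * g))⁻¹ *
      (σ (g * h) * t ((S.rightHom (σ (g * h)))⁻¹ * (g * h)))
    group

theorem exists_inl_mul_section (s : S.Section) (e : E) :
    ∃ z : Z, S.inl z * s (S.rightHom e) = e := by
  have : e * (s (S.rightHom e))⁻¹ ∈ S.inl.range := by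
    rw [S.range_inl_eq_ker_rightHom, MonoidHom.mem_ker]
    simp
  obtain ⟨z, hz⟩ := this
  exact ⟨z, by rw [hz]; group⟩

/-- The `Z`-component of an element of `E` relative to a section. -/
noncomputable def fiberCoord (s : S.Section) (e : E) : Z :=
  (S.exists_inl_mul_section s e).choose

theorem inl_fiberCoord_mul (s : S.Section) (e : E) :
    S.inl (S.fiberCoord s e) * s (S.rightHom e) = e :=
  (S.exists_inl_mul_section s e).choose_spec

theorem fiberCoord_inl_mul_section (s : S.Section) (z : Z) (g : G) :
    S.fiberCoord s (S.inl z * s g) = z := by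
  have h := S.inl_fiberCoord_mul s (S.inl z * s g)
  simp only [map_mul, rightHom_inl, Section.rightHom_section, one_mul] at h
  exact S.inl_injective (mul_right_cancel h)

/-- The bijection `E ≃ Z × G` given by a section. -/
noncomputable def sectionEquiv (s : S.Section) : E ≃ Z × G where
  toFun e := (S.fiberCoord s e, S.rightHom e)
  invFun y := S.inl y.1 * s y.2
  left_inv e := S.inl_fiberCoord_mul s e
  right_inv y := by
    refine Prod.ext (S.fiberCoord_inl_mul_section s _ _) ?_
    simp

theorem fg_of_fg (S : GroupExtension Z E G) [Group.FG Z] [Group.FG G] : Group.FG E := by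
  obtain ⟨A, hA⟩ := Group.fg_def.1 (inferInstance : Group.FG Z)
  obtain ⟨B, hB⟩ := Group.fg_def.1 (inferInstance : Group.FG G)
  let s := S.someSection
  refine Group.fg_iff.2 ⟨S.inl '' A ∪ s '' B, ?_,
    (A.finite_toSet.image _).union (B.finite_toSet.image _)⟩
  set K := Subgroup.closure (S.inl '' A ∪ s '' B)
  have h1 : S.inl.range ≤ K := by
    rw [MonoidHom.range_eq_map, ← hA, MonoidHom.map_closure]
    exact Subgroup.closure_mono Set.subset_union_left
  have h2 : K.map S.rightHom = ⊤ := by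
    rw [eq_top_iff, ← hB, Subgroup.closure_le]
    intro b hb
    exact ⟨s b, Subgroup.subset_closure (Or.inr ⟨b, hb, rfl⟩), by simp [s]⟩
  refine eq_top_iff.2 fun e _ => ?_
  obtain ⟨x, hx, hxe⟩ : S.rightHom e ∈ K.map S.rightHom := h2 ▸ Subgroup.mem_top _
  have : e * x⁻¹ ∈ S.inl.range := by
    rw [S.range_inl_eq_ker_rightHom, MonoidHom.mem_ker]
    simp [hxe]
  simpa using K.mul_mem (h1 this) hx

/-- The bijection `E ≃ Z × G` given by the section is itself the quasi-isometry, and it covers the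
projection to `G` exactly. -/
theorem isQITrivial_of_section (hS : S.IsCentral) [Group.FG Z] [Group.FG G] (s : S.Section)
    (hs : s.IsCoarselyLipschitz) : S.IsQITrivial := by
  have := S.fg_of_fg
  obtain ⟨A, hA⟩ := Group.fg_def.1 (inferInstance : Group.FG E)
  obtain ⟨B, hB⟩ := Group.fg_def.1 (inferInstance : Group.FG (Z × G))
  obtain ⟨C, hC⟩ := Group.fg_def.1 (inferInstance : Group.FG G)
  have c := fun z e => (Subgroup.mem_center_iff.1 (hS z) e)
  refine ⟨A, B, C, hA, hB, hC, S.sectionEquiv s,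
    isQuasiIsometry_of_equiv A.finite_toSet B.finite_toSet hA hB _ (fun a => ?_) (fun a => ?_),
    0, fun e => ?_⟩
  -- By centrality, `ζ(e)⁻¹ ζ(ea) = a (s(g)⁻¹ s(g π(a)))⁻¹`, where `g = π(e)` and `ζ` is the fiber
  -- coordinate.
  · have h1 : (Set.range fun e => S.inl ((S.fiberCoord s e)⁻¹ * S.fiberCoord s (e * a))).Finite := by
      refine (((((hs (S.rightHom a)).range_comp_fun (·⁻¹)).range_comp_fun
        (a * ·))).range_comp_right S.rightHom).subset ?_
      rintro _ ⟨e, rfl⟩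
      refine ⟨e, ?_⟩
      have h2 : ∀ e, S.inl (S.fiberCoord s e) = e * (s (S.rightHom e))⁻¹ := fun e =>
        eq_mul_inv_of_mul_eq (S.inl_fiberCoord_mul s e)
      have h3 := c ((S.fiberCoord s e)⁻¹ * S.fiberCoord s (e * a)) (s (S.rightHom e))
      refine mul_left_cancel (a := s (S.rightHom e)) ?_
      change _ = s (S.rightHom e) * S.inl ((S.fiberCoord s e)⁻¹ * S.fiberCoord s (e * a))
      rw [h3, map_mul, map_inv, h2, h2, map_mul]
      group
    have h5 := h1.range_comp_fun (Function.invFun S.inl)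
    simp only [Function.leftInverse_invFun S.inl_injective _] at h5
    refine (h5.prod (Set.finite_singleton (S.rightHom a))).subset ?_
    rintro _ ⟨e, rfl⟩
    refine ⟨⟨e, rfl⟩, ?_⟩
    simp [sectionEquiv]
  · refine ((hs a.2).range_comp_fun (S.inl a.1 * ·)).range_comp_right
      (Prod.snd : Z × G → G) |>.subset ?_
    rintro _ ⟨y, rfl⟩
    refine ⟨y, ?_⟩
    simp only [sectionEquiv, Equiv.coe_fn_symm_mk, Prod.fst_mul, Prod.snd_mul, map_mul]
    rw [mul_inv_rev, mul_assoc, mul_assoc (S.inl y.1), inv_mul_cancel_left, ← mul_assoc (s y.2)⁻¹, c, mul_assoc]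
  · simp [sectionEquiv, wordDist, wordLength_one]

end GroupExtension

/-! ### Gluing quasimorphisms along reduced words. -/

section Gluing

variable {E : Type*} [Group E]

/-- A word `l` with letters in `A false \ C` and `A true \ C`, alternately. -/
def IsReducedWord (A : Bool → Subgroup E) (C : Subgroup E) (l : List (Bool × E)) : Prop :=
  l.IsChain (fun a b => a.1 ≠ b.1) ∧ ∀ a ∈ l, a.2 ∈ A a.1 ∧ a.2 ∉ C

/-- The functions `F i`, defined on the subgroups `A i`, are odd and equivariant on both sides with
respect to the homomorphism `f` on the common subgroup `C`. -/
structure IsBiequivariant (A : Bool → Subgroup E) (C : Subgroup E) (F : Bool → E → ℝ)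
    (f : E → ℝ) : Prop where
  map_mul : ∀ k ∈ C, ∀ k' ∈ C, f (k * k') = f k + f k'
  left : ∀ i, ∀ k ∈ C, ∀ x ∈ A i, F i (k * x) = f k + F i x
  right : ∀ i, ∀ x ∈ A i, ∀ k ∈ C, F i (x * k) = F i x + f k
  inv : ∀ i, ∀ x ∈ A i, F i x⁻¹ = -F i x

/-- The sum of the values of `F` at the letters of a word. -/
def wordValue (F : Bool → E → ℝ) (l : List (Bool × E)) : ℝ :=
  (l.map fun a => F a.1 a.2).sum

/-- The product of the letters of a word. -/
def wordProd (l : List (Bool × E)) : E :=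
  (l.map Prod.snd).prod

/-- `r` is the value of a reduced expression of `e`. -/
def HasReducedValue (A : Bool → Subgroup E) (C : Subgroup E) (F : Bool → E → ℝ) (f : E → ℝ)
    (e : E) (r : ℝ) : Prop :=
  ∃ k ∈ C, ∃ l, IsReducedWord A C l ∧ e = k * wordProd l ∧ r = f k + wordValue F l

variable {A : Bool → Subgroup E} {C : Subgroup E} {F : Bool → E → ℝ} {f : E → ℝ} {D : ℝ}

namespace IsBiequivariant

variable (h : IsBiequivariant A C F f)
include h

theorem map_one : f 1 = 0 := by
  have := h.map_mul 1 C.one_mem 1 C.one_mem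
  rw [mul_one] at this
  linarith

theorem map_inv {k : E} (hk : k ∈ C) : f k⁻¹ = -f k := by
  have := h.map_mul k hk k⁻¹ (C.inv_mem hk)
  rw [mul_inv_cancel, h.map_one] at this
  linarith

theorem eq_of_mem {i : Bool} {k : E} (hk : k ∈ C) : F i k = f k := by
  have h1 := h.inv i 1 (A i).one_mem
  have h2 := h.left i k hk 1 (A i).one_mem
  rw [inv_one] at h1
  rw [mul_one] at h2
  linarith

/-- Multiply two reduced words and cancel at the junction. As long as the merged letters fall into
`C`, cancellation costs nothing, by equivariance and oddness. It stops at the first merged letter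
outside `C`, or when the adjacent letters lie in different factors, so the defect `D` is paid at
most once whatever the lengths. -/
theorem exists_wordProd_mul (hCA : ∀ i, C ≤ A i)
    (hD : ∀ i, ∀ x ∈ A i, ∀ y ∈ A i, |F i (x * y) - F i x - F i y| ≤ D)
    (l₁ : List (Bool × E)) (h₁ : IsReducedWord A C l₁) : ∀ (k : E), k ∈ C →
    ∀ l₂ : List (Bool × E), IsReducedWord A C l₂ →
      ∃ k' ∈ C, ∃ l, IsReducedWord A C l ∧ wordProd l₁ * k * wordProd l₂ = k' * wordProd l ∧
        |f k' + wordValue F l - (wordValue F l₁ + f k + wordValue F l₂)| ≤ D := by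
  have hD0 : 0 ≤ D := (abs_nonneg _).trans (hD true 1 (A _).one_mem 1 (A _).one_mem)
  induction l₁ using List.reverseRecOn with
  | nil =>
    intro k hk l₂ h₂
    exact ⟨k, hk, l₂, h₂, by simp [wordProd], by simpa [wordValue] using hD0⟩
  | append_singleton l₁ a ih =>
    obtain ⟨i, x⟩ := a
    intro k hk l₂ h₂
    obtain ⟨hx, hxC⟩ : x ∈ A i ∧ x ∉ C := h₁.2 (i, x) (by simp)
    have h₁' : IsReducedWord A C l₁ :=
      ⟨(List.isChain_append.1 h₁.1).1, fun a ha => h₁.2 a (by simp [ha])⟩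
    have hlast : ∀ a ∈ l₁.getLast?, a.1 ≠ i := fun a ha =>
      (List.isChain_append.1 h₁.1).2.2 a ha (i, x) (by simp)
    have happ : ∀ y, y ∈ A i → y ∉ C → ∀ l, IsReducedWord A C l → (∀ b ∈ l.head?, i ≠ b.1) →
        IsReducedWord A C (l₁ ++ (i, y) :: l) := by
      intro y hy hyC l hl hli
      refine ⟨List.isChain_append.2 ⟨h₁'.1, List.isChain_cons.2 ⟨hli, hl.1⟩, ?_⟩, ?_⟩
      · intro a ha b hb
        simp only [List.head?_cons, Option.mem_def, Option.some.injEq] at hb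
        subst hb
        exact hlast a ha
      · intro a ha
        rcases List.mem_append.1 ha with ha | ha
        · exact h₁'.2 a ha
        · rcases List.mem_cons.1 ha with rfl | ha
          · exact ⟨hy, hyC⟩
          · exact hl.2 a ha
    have hxk : x * k ∈ A i := (A i).mul_mem hx (hCA i hk)
    have hxkC : x * k ∉ C := fun h' => hxC (by simpa using C.mul_mem h' (C.inv_mem hk))
    by_cases hhead : ∀ b ∈ l₂.head?, i ≠ b.1
    · refine ⟨1, C.one_mem, _, happ _ hxk hxkC l₂ h₂ hhead, ?_, ?_⟩
      · simp [wordProd, mul_assoc]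
      · simp only [wordValue, List.map_append, List.map_cons, List.sum_append, List.sum_cons,
          List.map_nil, List.sum_nil, h.right i x hx k hk, h.map_one]
        ring_nf
        simpa using hD0
    · push Not at hhead
      obtain ⟨⟨j, y⟩, hb, hij⟩ := hhead
      simp only at hij
      subst hij
      obtain ⟨l₂, rfl⟩ : ∃ l, l₂ = (i, y) :: l := by
        cases l₂ with
        | nil => simp at hb
        | cons b l => exact ⟨l, by simpa using hb⟩
      obtain ⟨hy, hyC⟩ : y ∈ A i ∧ y ∉ C := h₂.2 (i, y) (by simp)
      have h₂' : IsReducedWord A C l₂ :=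
        ⟨(List.isChain_cons.1 h₂.1).2, fun a ha => h₂.2 a (by simp [ha])⟩
      have hz : x * k * y ∈ A i := (A i).mul_mem hxk hy
      by_cases hzC : x * k * y ∈ C
      · obtain ⟨k', hk', l, hl, hprod, hval⟩ := ih h₁' _ hzC l₂ h₂'
        refine ⟨k', hk', l, hl, ?_, ?_⟩
        · rw [← hprod]
          simp [wordProd, mul_assoc]
        -- Writing `y = (xk)⁻¹ (xky)` with `xky ∈ C`, right equivariance and oddness give an exact
        -- equality.
        · have hFz : f (x * k * y) = F i x + f k + F i y := by
            have e1 : y = (x * k)⁻¹ * (x * k * y) := by group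
            have e2 := h.right i (x * k)⁻¹ ((A i).inv_mem hxk) _ hzC
            rw [← e1, h.inv i _ hxk, h.right i x hx k hk] at e2
            linarith
          rw [hFz] at hval
          simp only [wordValue, List.map_append, List.map_cons, List.sum_append, List.sum_cons,
            List.map_nil, List.sum_nil] at hval ⊢
          convert hval using 2
          ring
      · refine ⟨1, C.one_mem, _, happ _ hz hzC l₂ h₂' (List.isChain_cons.1 h₂.1).1, ?_, ?_⟩
        · simp [wordProd, mul_assoc]
        · have := hD i _ hxk y hy
          rw [h.right i x hx k hk] at this
          simp only [wordValue, List.map_append, List.map_cons, List.sum_append, List.sum_cons,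
            List.map_nil, List.sum_nil, h.map_one] at this ⊢
          convert this using 2
          ring

theorem hasReducedValue_mul (hCA : ∀ i, C ≤ A i)
    (hD : ∀ i, ∀ x ∈ A i, ∀ y ∈ A i, |F i (x * y) - F i x - F i y| ≤ D) {e e' : E} {r r' : ℝ}
    (he : HasReducedValue A C F f e r) (he' : HasReducedValue A C F f e' r') :
    ∃ r'', HasReducedValue A C F f (e * e') r'' ∧ |r'' - (r + r')| ≤ D := by
  obtain ⟨k, hk, l, hl, rfl, rfl⟩ := he
  obtain ⟨k', hk', l', hl', rfl, rfl⟩ := he'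
  obtain ⟨k'', hk'', l'', hl'', hprod, hval⟩ := h.exists_wordProd_mul hCA hD l hl k' hk' l' hl'
  refine ⟨f (k * k'') + wordValue F l'',
    ⟨k * k'', C.mul_mem hk hk'', l'', hl'', ?_, rfl⟩, ?_⟩
  · rw [mul_assoc k k'', ← hprod]
    simp only [mul_assoc]
  · rw [h.map_mul k hk k'' hk'']
    convert hval using 2
    ring

theorem hasReducedValue_of_mem {i : Bool} {x : E} (hx : x ∈ A i) :
    HasReducedValue A C F f x (F i x) := by
  by_cases hxC : x ∈ C
  · exact ⟨x, hxC, [], ⟨List.isChain_nil, by simp⟩, by simp [wordProd],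
      by simp [wordValue, h.eq_of_mem hxC]⟩
  · exact ⟨1, C.one_mem, [(i, x)], ⟨List.isChain_singleton _, by simp [hx, hxC]⟩,
      by simp [wordProd], by simp [wordValue, h.map_one]⟩

theorem hasReducedValue_inv (hCA : ∀ i, C ≤ A i)
    (hD : ∀ i, ∀ x ∈ A i, ∀ y ∈ A i, |F i (x * y) - F i x - F i y| ≤ D) {e : E} {r : ℝ}
    (he : HasReducedValue A C F f e r) :
    ∃ r', HasReducedValue A C F f e⁻¹ r' ∧ |r' + r| ≤ D := by
  obtain ⟨k, hk, l, hl, rfl, rfl⟩ := he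
  have h1 : IsReducedWord A C (l.map fun a => (a.1, a.2⁻¹)).reverse := by
    refine ⟨?_, ?_⟩
    · rw [List.isChain_reverse, List.isChain_map]
      exact hl.1.imp fun a b hab => hab.symm
    · simp only [List.mem_reverse, List.mem_map]
      rintro _ ⟨a, ha, rfl⟩
      exact ⟨(A _).inv_mem (hl.2 a ha).1, fun h' => (hl.2 a ha).2 (by simpa using C.inv_mem h')⟩
  have h2 : wordProd (l.map fun a => (a.1, a.2⁻¹)).reverse = (wordProd l)⁻¹ := by
    simp [wordProd, List.prod_inv_reverse, Function.comp_def]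
  have h3 : wordValue F (l.map fun a => (a.1, a.2⁻¹)).reverse = -wordValue F l := by
    have hF : ∀ a ∈ l, F a.1 a.2⁻¹ = -F a.1 a.2 := fun a ha => h.inv _ _ (hl.2 a ha).1
    clear hl h1 h2
    simp only [wordValue, List.map_reverse, List.map_map, List.sum_reverse]
    induction l with
    | nil => simp
    | cons a l ih =>
      simp only [List.map_cons, List.sum_cons, Function.comp_apply]
      rw [ih fun b hb => hF b (by simp [hb]), hF a (by simp)]
      ring
  obtain ⟨k', hk', l', hl', hprod, hval⟩ := h.exists_wordProd_mul hCA hD _ h1 k⁻¹ (C.inv_mem hk)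
    [] ⟨List.isChain_nil, by simp⟩
  refine ⟨_, ⟨k', hk', l', hl', ?_, rfl⟩, ?_⟩
  · rw [← hprod, h2]
    simp [wordProd]
  · rw [h3, h.map_inv hk] at hval
    simp only [wordValue, List.map_nil, List.sum_nil] at hval ⊢
    convert hval using 2
    ring

/-- Quasimorphisms on two subgroups which are biequivariant with respect to the same homomorphism
on a common subgroup `C` extend, up to a bounded error, to a quasimorphism on the group, if
the group is the amalgamated product of the two subgroups over `C`. -/
theorem exists_quasimorphism (hCA : ∀ i, C ≤ A i)
    (hD : ∀ i, ∀ x ∈ A i, ∀ y ∈ A i, |F i (x * y) - F i x - F i y| ≤ D)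
    (hsup : ⨆ i, A i = ⊤) (hred : ∀ l, IsReducedWord A C l → wordProd l ∈ C → l = []) :
    ∃ (Φ : E → ℝ) (K : ℝ), (∀ x y, |Φ (x * y) - Φ x - Φ y| ≤ K) ∧
      ∀ i, ∀ x ∈ A i, |Φ x - F i x| ≤ K := by
  have hD0 : 0 ≤ D := (abs_nonneg _).trans (hD true 1 (A _).one_mem 1 (A _).one_mem)
  have hex : ∀ e, ∃ r, HasReducedValue A C F f e r := by
    intro e
    have he : e ∈ ⨆ i, A i := hsup ▸ Subgroup.mem_top e
    induction he using Subgroup.iSup_induction' with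
    | hp i x hx => exact ⟨_, h.hasReducedValue_of_mem hx⟩
    | h1 => exact ⟨_, h.hasReducedValue_of_mem (A true).one_mem⟩
    | hmul x y _ _ hx hy =>
      obtain ⟨r, hr⟩ := hx
      obtain ⟨r', hr'⟩ := hy
      obtain ⟨r'', hr'', -⟩ := h.hasReducedValue_mul hCA hD hr hr'
      exact ⟨r'', hr''⟩
  -- Here the normal form theorem enters: an expression of `1` has an empty word.
  have hone : ∀ r, HasReducedValue A C F f 1 r → r = 0 := by
    rintro r ⟨k, hk, l, hl, hkl, rfl⟩
    have h0 : wordProd l = k⁻¹ := (inv_eq_of_mul_eq_one_right hkl.symm).symm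
    obtain rfl := hred l hl (h0 ▸ C.inv_mem hk)
    have h1 : k = 1 := by simpa [wordProd] using hkl.symm
    subst h1
    simp [wordValue, h.map_one]
  -- Compare both values through `e⁻¹ e = 1`: one `D` for the inverse and one for the product. Hence
  -- any choice of values is good enough to define `Φ`.
  have huniq : ∀ e r r', HasReducedValue A C F f e r → HasReducedValue A C F f e r' →
      |r - r'| ≤ 2 * D := by
    intro e r r' hr hr'
    obtain ⟨r₁, hr₁, hb₁⟩ := h.hasReducedValue_inv hCA hD hr
    obtain ⟨r₂, hr₂, hb₂⟩ := h.hasReducedValue_mul hCA hD hr₁ hr'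
    rw [inv_mul_cancel] at hr₂
    rw [hone _ hr₂] at hb₂
    rw [abs_le] at hb₁ hb₂ ⊢
    constructor <;> linarith [hb₁.1, hb₁.2, hb₂.1, hb₂.2]
  choose Φ hΦ using hex
  refine ⟨Φ, 3 * D, fun x y => ?_, fun i x hx => ?_⟩
  · obtain ⟨r, hr, hb⟩ := h.hasReducedValue_mul hCA hD (hΦ x) (hΦ y)
    have hu := huniq _ _ _ (hΦ (x * y)) hr
    rw [abs_le] at hb hu ⊢
    constructor <;> linarith [hb.1, hb.2, hu.1, hu.2]
  · linarith [huniq _ _ _ (hΦ x) (h.hasReducedValue_of_mem hx)]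

end IsBiequivariant

end Gluing

/-! ### Averaging over the amenable group `H`. -/

section Mean

/-- `M` is a right-invariant mean on the bounded real functions on `H`. -/
structure IsRightInvariantMean {H : Type*} [Group H] (M : (H → ℝ) → ℝ) : Prop where
  add : ∀ u v (B B' : ℝ), (∀ x, |u x| ≤ B) → (∀ x, |v x| ≤ B') →
    M (fun x => u x + v x) = M u + M v
  const : ∀ c : ℝ, M (fun _ => c) = c
  abs_le_of_forall : ∀ u (B : ℝ), (∀ x, |u x| ≤ B) → |M u| ≤ B
  trans : ∀ (g : H) u (B : ℝ), (∀ x, |u x| ≤ B) → M (fun x => u (x * g)) = M u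

theorem IsAmenableGroup.exists_isRightInvariantMean {H : Type*} [Group H]
    (hH : IsAmenableGroup H) : ∃ M : (H → ℝ) → ℝ, IsRightInvariantMean M := by
  classical
  obtain ⟨m, hpos, hone, hinv⟩ := hH
  have hmem : ∀ (u : H → ℝ) (B : ℝ), (∀ x, |u x| ≤ B) → Memℓp (E := fun _ : H => ℝ) u ⊤ :=
    fun u B hu => memℓp_infty ⟨B, by rintro _ ⟨x, rfl⟩; exact hu x⟩
  let M : (H → ℝ) → ℝ := fun u =>
    if hu : Memℓp (E := fun _ : H => ℝ) u ⊤ then m ⟨u, hu⟩ else 0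
  have hM : ∀ u (hu : Memℓp (E := fun _ : H => ℝ) u ⊤), M u = m ⟨u, hu⟩ := fun u hu => dif_pos hu
  have hconst : ∀ c : ℝ, M (fun _ => c) = c := by
    intro c
    rw [hM _ (hmem _ |c| fun _ => le_rfl)]
    have : (⟨fun _ => c, hmem _ |c| fun _ => le_rfl⟩ : lp (fun _ : H => ℝ) ⊤) = c • 1 := by
      ext x
      simp
    rw [this, map_smul, hone, smul_eq_mul, mul_one]
  have hadd : ∀ u v (B B' : ℝ), (∀ x, |u x| ≤ B) → (∀ x, |v x| ≤ B') →
      M (fun x => u x + v x) = M u + M v := by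
    intro u v B B' hu hv
    have huv : ∀ x, |u x + v x| ≤ B + B' := fun x =>
      (abs_add_le _ _).trans (add_le_add (hu x) (hv x))
    rw [hM _ (hmem _ _ huv), hM _ (hmem _ _ hu), hM _ (hmem _ _ hv), ← map_add]
    rfl
  have hnonneg : ∀ u (B : ℝ), (∀ x, |u x| ≤ B) → (∀ x, 0 ≤ u x) → 0 ≤ M u := by
    intro u B hu h0
    rw [hM _ (hmem _ _ hu)]
    exact hpos _ h0
  refine ⟨M, hadd, hconst, fun u B hu => ?_, fun g u B hu => ?_⟩
  · have hB : ∀ x : H, |(fun _ : H => B) x| ≤ |B| := fun _ => le_rfl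
    have hneg : M (fun x => -u x) = -M u := by
      have := hadd u (fun x => -u x) B B hu (by simpa using hu)
      simp only [add_neg_cancel, hconst 0] at this
      linarith
    have h1 := hadd _ u _ _ hB hu
    have h2 := hadd _ (fun x => -u x) _ B hB (by simpa using hu)
    have h3 := hnonneg (fun x => B + u x) (|B| + B)
      (fun x => (abs_add_le _ _).trans (add_le_add le_rfl (hu x)))
      (fun x => by linarith [(abs_le.1 (hu x)).1])
    have h4 := hnonneg (fun x => B + -u x) (|B| + B)
      (fun x => (abs_add_le _ _).trans (add_le_add le_rfl (by simpa using hu x)))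
      (fun x => by linarith [(abs_le.1 (hu x)).2])
    rw [h1, hconst] at h3
    rw [h2, hconst, hneg] at h4
    exact abs_le.2 ⟨by linarith, by linarith⟩
  · rw [hM _ (hmem _ _ fun x => hu (x * g)), hM _ (hmem _ _ hu)]
    exact hinv g _ _ fun x => rfl

variable {E H : Type*} [Group E] [Group H] {M : (H → ℝ) → ℝ}

/-- The subgroup `C` is an extension of `H` by a central subgroup `N`, with set-theoretic
section `σ`. -/
structure IsCentralTransversal (N C : Subgroup E) (σ : H → E) : Prop where
  le_center : N ≤ Subgroup.center E
  le : N ≤ C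
  mem : ∀ h, σ h ∈ C
  exists_mul : ∀ k ∈ C, ∃ h, ∀ g, ∃ z ∈ N, σ g * k = z * σ (g * h)

variable {N C A : Subgroup E} {σ : H → E}

/-- Average `F(xk) - F(x)` over `x`. By equivariance under `N` this depends only on the class of `x`
modulo `N`, so a mean on `H` suffices, and its invariance makes the average additive in `k`. -/
theorem IsRightInvariantMean.exists_hom_near (hM : IsRightInvariantMean M)
    (hσ : IsCentralTransversal N C σ) {F p : E → ℝ} {D : ℝ}
    (hD : ∀ x ∈ C, ∀ y ∈ C, |F (x * y) - F x - F y| ≤ D)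
    (hp : ∀ z ∈ N, ∀ x ∈ C, F (z * x) = p z + F x) :
    ∃ f : E → ℝ, (∀ k ∈ C, ∀ k' ∈ C, f (k * k') = f k + f k') ∧ (∀ z ∈ N, f z = p z) ∧
      ∀ k ∈ C, |f k - F k| ≤ D := by
  have hb : ∀ k ∈ C, ∀ h, |(F (σ h * k) - F (σ h)) - F k| ≤ D := fun k hk h =>
    hD _ (hσ.mem h) k hk
  have hb' : ∀ k ∈ C, ∀ h, |F (σ h * k) - F (σ h)| ≤ |F k| + D := fun k hk h => by
    linarith [hb k hk h, abs_sub_abs_le_abs_sub (F (σ h * k) - F (σ h)) (F k)]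
  refine ⟨fun k => M fun h => F (σ h * k) - F (σ h), fun k hk k' hk' => ?_, fun z hz => ?_,
    fun k hk => ?_⟩
  · obtain ⟨g, hg⟩ := hσ.exists_mul k hk
    have h1 := hM.trans g _ _ (hb' k' hk')
    have h2 : (fun h => F (σ (h * g) * k') - F (σ (h * g))) =
        fun h => F (σ h * k * k') - F (σ h * k) := by
      funext h
      obtain ⟨z, hz, he⟩ := hg h
      rw [he, mul_assoc, hp z hz _ (C.mul_mem (hσ.mem _) hk'), hp z hz _ (hσ.mem _)]
      ring
    have h3 := hM.add (fun h => F (σ h * k) - F (σ h))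
      (fun h => F (σ (h * g) * k') - F (σ (h * g))) _ _ (hb' k hk)
      (fun h => hb' k' hk' (h * g))
    rw [h1] at h3
    change M (fun h => F (σ h * (k * k')) - F (σ h)) = _
    rw [← h3]
    congr 1
    funext h
    rw [congrFun h2 h, mul_assoc]
    ring
  · have : (fun h => F (σ h * z) - F (σ h)) = fun _ => p z := by
      funext h
      rw [Subgroup.mem_center_iff.1 (hσ.le_center hz) (σ h), hp z hz _ (hσ.mem h)]
      ring
    simp only [this, hM.const]
  · have h1 := hM.add _ (fun _ => -F k) _ _ (hb' k hk) (fun _ => le_rfl)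
    rw [hM.const, ← sub_eq_add_neg] at h1
    change |M (fun h => F (σ h * k) - F (σ h)) - F k| ≤ D
    rw [← h1]
    exact hM.abs_le_of_forall _ _ fun h => hb k hk h

/-- Average `F(cx) - f(c)` over `c` in `C` modulo `N`. Left averaging commutes with right
translations, so it preserves right equivariance; the last clause allows a second averaging for the
other side. -/
theorem IsRightInvariantMean.exists_left_equivariant (hM : IsRightInvariantMean M)
    (hσ : IsCentralTransversal N C σ) (hCA : C ≤ A) {F f : E → ℝ} {D : ℝ}
    (hf : ∀ k ∈ C, ∀ k' ∈ C, f (k * k') = f k + f k')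
    (hD : ∀ k ∈ C, ∀ x ∈ A, |F (k * x) - f k - F x| ≤ D)
    (hp : ∀ z ∈ N, ∀ x ∈ A, F (z * x) = f z + F x) :
    ∃ F' : E → ℝ, (∀ k ∈ C, ∀ x ∈ A, F' (k * x) = f k + F' x) ∧
      (∀ x ∈ A, |F' x - F x| ≤ D) ∧
      ((∀ x ∈ A, ∀ k ∈ C, F (x * k) = F x + f k) → ∀ x ∈ A, ∀ k ∈ C, F' (x * k) = F' x + f k) := by
  have hb : ∀ x ∈ A, ∀ h, |(F (σ h * x) - f (σ h)) - F x| ≤ D := fun x hx h =>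
    hD _ (hσ.mem h) x hx
  have hb' : ∀ x ∈ A, ∀ h, |F (σ h * x) - f (σ h)| ≤ |F x| + D := fun x hx h => by
    linarith [hb x hx h, abs_sub_abs_le_abs_sub (F (σ h * x) - f (σ h)) (F x)]
  have hadd : ∀ x ∈ A, ∀ c, M (fun h => (F (σ h * x) - f (σ h)) + c) =
      M (fun h => F (σ h * x) - f (σ h)) + c := fun x hx c => by
    rw [hM.add _ (fun _ => c) _ _ (hb' x hx) (fun _ => le_rfl), hM.const]
  refine ⟨fun x => M fun h => F (σ h * x) - f (σ h), fun k hk x hx => ?_, fun x hx => ?_,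
    fun hr x hx k hk => ?_⟩
  · obtain ⟨g, hg⟩ := hσ.exists_mul k hk
    have h1 := hM.trans g _ _ (hb' x hx)
    change M (fun h => F (σ h * (k * x)) - f (σ h)) = _ + M (fun h => F (σ h * x) - f (σ h))
    rw [add_comm, ← hadd x hx, ← hM.trans g _ (|F x| + D + |f k|) fun h =>
      (abs_add_le _ _).trans (add_le_add (hb' x hx h) le_rfl)]
    congr 1
    funext h
    obtain ⟨z, hz, he⟩ := hg h
    have h2 := hf z (hσ.le hz) _ (hσ.mem (h * g))
    rw [← he, hf _ (hσ.mem h) k hk] at h2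
    rw [← mul_assoc, he, mul_assoc, hp z hz _ (A.mul_mem (hCA (hσ.mem _)) hx)]
    linarith
  · change |M (fun h => F (σ h * x) - f (σ h)) - F x| ≤ D
    rw [sub_eq_add_neg, ← hadd x hx]
    exact hM.abs_le_of_forall _ _ fun h => hb x hx h
  · change M (fun h => F (σ h * (x * k)) - f (σ h)) = M (fun h => F (σ h * x) - f (σ h)) + _
    rw [← hadd x hx]
    congr 1
    funext h
    rw [← mul_assoc, hr _ (A.mul_mem (hCA (hσ.mem h)) hx) k hk]
    ring

/-- A quasimorphism on `A` which is close to a homomorphism on the amenable subgroup `C` is close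
to an odd function which is biequivariant under `C`. -/
theorem IsRightInvariantMean.exists_biequivariant (hM : IsRightInvariantMean M)
    (hσ : IsCentralTransversal N C σ) (hCA : C ≤ A) {F f : E → ℝ} {D B : ℝ}
    (hf : ∀ k ∈ C, ∀ k' ∈ C, f (k * k') = f k + f k')
    (hD : ∀ x ∈ A, ∀ y ∈ A, |F (x * y) - F x - F y| ≤ D)
    (hB : ∀ k ∈ C, |F k - f k| ≤ B)
    (hp : ∀ z ∈ N, ∀ x ∈ A, F (z * x) = f z + F x) :
    ∃ (F' : E → ℝ) (K : ℝ), (∀ k ∈ C, ∀ x ∈ A, F' (k * x) = f k + F' x) ∧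
      (∀ x ∈ A, ∀ k ∈ C, F' (x * k) = F' x + f k) ∧ (∀ x ∈ A, F' x⁻¹ = -F' x) ∧
      ∀ x ∈ A, |F' x - F x| ≤ K := by
  have hf1 : f 1 = 0 := by
    have := hf 1 C.one_mem 1 C.one_mem
    rw [mul_one] at this
    linarith
  have hfinv : ∀ k ∈ C, f k⁻¹ = -f k := by
    intro k hk
    have := hf k hk k⁻¹ (C.inv_mem hk)
    rw [mul_inv_cancel, hf1] at this
    linarith
  -- `Fa` is left equivariant, hence `x ↦ -Fa(x⁻¹)` is right equivariant. Averaging that function on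
  -- the left yields `Fc`, equivariant on both sides.
  obtain ⟨Fa, hal, ha, -⟩ := hM.exists_left_equivariant hσ hCA (F := F) (D := D + B) hf
    (fun k hk x hx => by
      have h1 := hD k (hCA hk) x hx
      have h2 := hB k hk
      rw [abs_le] at h1 h2 ⊢
      constructor <;> linarith [h1.1, h1.2, h2.1, h2.2]) hp
  have hbr : ∀ x ∈ A, ∀ k ∈ C, -Fa (x * k)⁻¹ = -Fa x⁻¹ + f k := by
    intro x hx k hk
    rw [mul_inv_rev, hal _ (C.inv_mem hk) _ (A.inv_mem hx), hfinv k hk]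
    ring
  obtain ⟨Fc, hcl, hc, hcr⟩ := hM.exists_left_equivariant hσ hCA (F := fun x => -Fa x⁻¹)
    (D := 3 * (D + B)) hf
    (fun k hk x hx => by
      have hki := C.inv_mem hk
      have hxi := A.inv_mem hx
      have h1 := hD _ hxi _ (hCA hki)
      have h2 := hB _ hki
      have h3 := ha _ hxi
      have h4 := ha _ (A.mul_mem hxi (hCA hki))
      rw [mul_inv_rev]
      rw [hfinv k hk] at h2
      rw [abs_le] at h1 h2 h3 h4 ⊢
      constructor <;> linarith [h1.1, h1.2, h2.1, h2.2, h3.1, h3.2, h4.1, h4.2])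
    (fun z hz x hx => by
      have := hbr x hx z (hσ.le hz)
      rw [Subgroup.mem_center_iff.1 (hσ.le_center hz) x] at this
      rw [this, add_comm])
  have hcr := hcr hbr
  -- Antisymmetrization keeps both equivariances. It stays close to `F` because `F(x) + F(x⁻¹)` is
  -- within `D` of `F(1)`, and `|F(1)| ≤ D`.
  refine ⟨fun x => (Fc x - Fc x⁻¹) / 2, 4 * (D + B) + 2 * D, fun k hk x hx => ?_,
    fun x hx k hk => ?_, fun x hx => ?_, fun x hx => ?_⟩
  · simp only
    rw [mul_inv_rev, hcl k hk x hx, hcr _ (A.inv_mem hx) _ (C.inv_mem hk), hfinv k hk]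
    ring
  · simp only
    rw [mul_inv_rev, hcr x hx k hk, hcl _ (C.inv_mem hk) _ (A.inv_mem hx), hfinv k hk]
    ring
  · simp only
    rw [inv_inv]
    ring
  · have hxi := A.inv_mem hx
    have h1 := hc x hx
    have h2 := hc _ hxi
    have h3 := ha x hx
    have h4 := ha _ hxi
    have h5 := hD x hx _ hxi
    have h6 := hD 1 A.one_mem 1 A.one_mem
    rw [mul_inv_cancel] at h5
    rw [mul_one] at h6
    rw [inv_inv] at h2
    rw [abs_le] at h1 h2 h3 h4 h5 h6 ⊢
    simp only
    constructor <;> linarith [h1.1, h1.2, h2.1, h2.2, h3.1, h3.2, h4.1, h4.2, h5.1, h5.2,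
      h6.1, h6.2]

end Mean

/-! ### Transversality, dually: extending homomorphisms from `H` to `ℝ`. -/

section Transverse

/-- The class in `H₁(G, ℝ)` of an element of `G`. -/
noncomputable def realH1Class {G : Type} [Group G] (g : G) :
    groupHomology.H1 (Rep.trivial ℝ G ℝ) :=
  groupHomology.mkH1OfIsTrivial (Rep.trivial ℝ G ℝ)
    (Additive.ofMul (Abelianization.of g)) (1 : ℝ)

theorem realH1Class_mul {G : Type} [Group G] (g h : G) :
    realH1Class (g * h) = realH1Class g + realH1Class h := by
  simp only [realH1Class, map_mul, ofMul_mul, map_add, LinearMap.add_apply]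

theorem realH1Map_realH1Class {G K : Type} [Group G] [Group K] (f : G →* K) (g : G) :
    realH1Map f (realH1Class g) = realH1Class (f g) := by
  simp only [realH1Class]
  rw [groupHomology.mkH1OfIsTrivial_apply (A := Rep.trivial ℝ G ℝ),
    groupHomology.mkH1OfIsTrivial_apply (A := Rep.trivial ℝ K ℝ)]
  refine (groupHomology.H1π_comp_map_apply f (realCoeffHom f) _).trans ?_
  congr 1
  refine Subtype.ext ?_
  rw [groupHomology.coe_mapCycles₁]
  refine (congrArg (groupHomology.chainsMap₁ f (realCoeffHom f))
    (groupHomology.cycles₁IsoOfIsTrivial_inv_apply (A := Rep.trivial ℝ G ℝ) _)).trans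
    (Eq.trans ?_
    (groupHomology.cycles₁IsoOfIsTrivial_inv_apply (A := Rep.trivial ℝ K ℝ) _).symm)
  simp [realCoeffHom]

/-- Under `H₁(G, ℝ) ≅ Gᵃᵇ ⊗ ℝ` the class of `g` is `g ⊗ 1`, and `μ` is `g ⊗ r ↦ t(g) r`. -/
theorem exists_additive_realH1Class {G : Type} [Group G] (t : G → ℝ)
    (ht : ∀ g h, t (g * h) = t g + t h) :
    ∃ μ : groupHomology.H1 (Rep.trivial ℝ G ℝ) →+ ℝ, ∀ g, μ (realH1Class g) = t g := by
  let τ : Additive (Abelianization G) →+ ℝ :=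
    MonoidHom.toAdditiveLeft (Abelianization.lift
      (MonoidHom.mk' (fun g => Multiplicative.ofAdd (t g)) fun g h => congrArg _ (ht g h)))
  let ν : TensorProduct ℤ (Additive (Abelianization G)) ℝ →ₗ[ℤ] ℝ :=
    TensorProduct.lift ((LinearMap.mul ℤ ℝ).comp τ.toIntLinearMap)
  refine ⟨ν.toAddMonoidHom.comp
    (groupHomology.H1AddEquivOfIsTrivial (Rep.trivial ℝ G ℝ)).toAddMonoidHom, fun g => ?_⟩
  have h1 : groupHomology.H1AddEquivOfIsTrivial (Rep.trivial ℝ G ℝ) (realH1Class g) =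
      TensorProduct.tmul ℤ (Additive.ofMul (Abelianization.of g)) (1 : ℝ) :=
    groupHomology.H1AddEquivOfIsTrivial_single (A := Rep.trivial ℝ G ℝ) g (1 : ℝ)
  refine (congrArg ν h1).trans ?_
  refine (TensorProduct.lift.tmul (R := ℤ) (Additive.ofMul (Abelianization.of g)) (1 : ℝ)).trans ?_
  change τ (Additive.ofMul (Abelianization.of g)) * 1 = t g
  simp [τ]

/-- An injective linear map of real vector spaces has a left inverse, through which the functional
on `H₁(H, ℝ)` extends to the direct sum. -/
theorem IsTransverse.exists_eq_add {H G₁ G₂ : Type} [Group H] [Group G₁] [Group G₂]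
    {i₁ : H →* G₁} {i₂ : H →* G₂} (h : IsTransverse i₁ i₂) (t : H → ℝ)
    (ht : ∀ g h, t (g * h) = t g + t h) :
    ∃ (t₁ : G₁ → ℝ) (t₂ : G₂ → ℝ), (∀ g h, t₁ (g * h) = t₁ g + t₁ h) ∧
      (∀ g h, t₂ (g * h) = t₂ g + t₂ h) ∧ ∀ g, t g = t₁ (i₁ g) + t₂ (i₂ g) := by
  obtain ⟨μ, hμ⟩ := exists_additive_realH1Class t ht
  obtain ⟨ρ, hρ⟩ := LinearMap.exists_leftInverse_of_injective _ (LinearMap.ker_eq_bot.2 h)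
  refine ⟨fun g => μ (ρ (realH1Class g, 0)), fun g => μ (ρ (0, realH1Class g)),
    fun g h => ?_, fun g h => ?_, fun g => ?_⟩
  · simp only
    rw [realH1Class_mul, ← map_add, ← map_add, Prod.mk_add_mk, add_zero]
  · simp only
    rw [realH1Class_mul, ← map_add, ← map_add, Prod.mk_add_mk, add_zero]
  · rw [← hμ, ← map_add, ← map_add, Prod.mk_add_mk, add_zero, zero_add,
      ← realH1Map_realH1Class, ← realH1Map_realH1Class]
    exact congrArg μ (LinearMap.congr_fun hρ (realH1Class g)).symm

end Transverse

/-! ### Pullbacks of extensions and boundedness of the Euler class. -/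

namespace GroupExtension

section Pullback

variable {Z E G G' : Type*} [Group Z] [Group E] [Group G] [Group G'] (S : GroupExtension Z E G)
  (ι : G' →* G)

/-- The pullback of an extension of `G` along a homomorphism `ι : G' → G`. -/
def pullback : GroupExtension Z
    ↥((S.rightHom.comp (MonoidHom.fst E G')).eqLocus (ι.comp (MonoidHom.snd E G'))) G' where
  inl := (MonoidHom.inl E G').comp S.inl |>.codRestrict _ fun z => by
    change S.rightHom (S.inl z) = ι 1
    simp
  rightHom := (MonoidHom.snd E G').comp (Subgroup.subtype _)
  inl_injective z z' h := S.inl_injective (congrArg (fun e => e.1.1) h)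
  range_inl_eq_ker_rightHom := by
    ext ⟨⟨e, g⟩, he⟩
    replace he : S.rightHom e = ι g := he
    constructor
    · rintro ⟨z, hz⟩
      exact (congrArg (fun e => e.1.2) hz).symm
    · intro h
      replace h : g = 1 := h
      subst h
      rw [map_one, ← MonoidHom.mem_ker, ← S.range_inl_eq_ker_rightHom] at he
      obtain ⟨z, rfl⟩ := he
      exact ⟨z, rfl⟩
  rightHom_surjective g :=
    ⟨⟨(S.someSection (ι g), g), by
      change S.rightHom (S.someSection (ι g)) = ι g
      simp⟩, rfl⟩

theorem IsCentral.pullback (hS : S.IsCentral) : (S.pullback ι).IsCentral := by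
  refine fun z => Subgroup.mem_center_iff.2 ?_
  rintro ⟨⟨e, g⟩, he⟩
  refine Subtype.ext (Prod.ext (Subgroup.mem_center_iff.1 (hS z) e) ?_)
  change g * 1 = 1 * g
  simp

variable {S}

/-- The section of a pullback induced by a section. -/
def Section.pullback (s : S.Section) : (S.pullback ι).Section where
  toFun g := ⟨(s (ι g), g), by
    change S.rightHom (s (ι g)) = ι g
    simp⟩
  rightInverse_rightHom _ := rfl

theorem Section.IsCoarselyLipschitz.pullback {s : S.Section} (hs : s.IsCoarselyLipschitz) :
    (s.pullback ι).IsCoarselyLipschitz := by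
  intro h
  refine Set.Finite.of_finite_image (f := Subtype.val) ?_ Subtype.val_injective.injOn
  refine (((hs (ι h)).range_comp_right ι).prod (Set.finite_singleton h)).subset ?_
  rintro _ ⟨_, ⟨g, rfl⟩, rfl⟩
  refine ⟨⟨g, ?_⟩, ?_⟩
  · change (s (ι g))⁻¹ * s (ι g * ι h) = (s (ι g))⁻¹ * s (ι (g * h))
    rw [map_mul ι]
  · change g⁻¹ * (g * h) = h
    group

theorem sectionCochain_pullback (s : S.Section) (g h : G') :
    (S.pullback ι).sectionCochain (s.pullback ι) (g, h) = S.sectionCochain s (ι g, ι h) := by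
  apply S.inl_injective
  rw [inl_sectionCochain, ← map_mul ι]
  exact congrArg (fun e => e.1.1) ((S.pullback ι).inl_sectionCochain (s.pullback ι) g h)

end Pullback

section Bounded

variable {Z E G : Type} [CommGroup Z] [Group E] [Group G] (S : GroupExtension Z E G)

/-- The Euler class is bounded if and only if the cocycle of a section is at finite distance from
a coboundary. -/
theorem isBoundedClass_eulerClass_iff (hS : S.IsCentral) (s : S.Section) :
    IsBoundedClass (S.eulerClass hS) ↔ ∃ φ : G → Z, (Set.range fun p : G × G =>
      S.sectionCochain s p * (φ p.2 / φ (p.1 * p.2) * φ p.1)).Finite := by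
  rw [eulerClass_eq S hS s]
  constructor
  · rintro ⟨ω, hω, hfin⟩
    obtain ⟨φ, hφ⟩ := (groupCohomology.H2π_eq_iff _ _).1 hω
    refine ⟨fun g => Additive.toMul (φ g : Additive Z), ?_⟩
    refine (hfin.range_comp_fun (Additive.toMul (α := Z))).subset ?_
    rintro _ ⟨p, rfl⟩
    refine ⟨p, ?_⟩
    have h := congrFun hφ p
    have h' : (φ p.2 : Additive Z) - (φ (p.1 * p.2) : Additive Z) + (φ p.1 : Additive Z) =
      (ω p : Additive Z) - Additive.ofMul (S.sectionCochain s p) := h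
    have h'' := sub_eq_iff_eq_add'.1 h'.symm
    exact congrArg Additive.toMul h''
  · rintro ⟨φ, hφ⟩
    let A := Rep.trivial ℤ G (Additive Z)
    let b : G → A := fun g => Additive.ofMul (φ g)
    let δ : groupCohomology.cocycles₂ A := ⟨groupCohomology.d₁₂ A b,
      groupCohomology.coboundaries₂_le_cocycles₂ A ⟨b, rfl⟩⟩
    refine ⟨S.sectionCocycle hS s + δ, (groupCohomology.H2π_eq_iff _ _).2 ⟨b, ?_⟩, ?_⟩
    · funext p
      change _ = (S.sectionCocycle hS s p + δ p : Additive Z) - (S.sectionCocycle hS s p)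
      rw [add_sub_cancel_left]
      rfl
    · refine (hφ.range_comp_fun (Additive.ofMul (α := Z))).subset ?_
      rintro _ ⟨p, rfl⟩
      exact ⟨p, rfl⟩

end Bounded

/-- If `G'` has Property QITB, the restriction to `G'` of the cocycle of a coarsely Lipschitz
section is at finite distance from a coboundary. -/
theorem exists_finite_range_of_propertyQITB {Z E G G' : Type} [CommGroup Z] [Group E] [Group G]
    [Group G'] (S : GroupExtension Z E G) (hS : S.IsCentral) (hZ : Group.FG Z) (s : S.Section)
    (hs : s.IsCoarselyLipschitz) (ι : G' →* G) (hG' : PropertyQITB G') :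
    ∃ φ : G' → Z, (Set.range fun p : G' × G' =>
      S.sectionCochain s (ι p.1, ι p.2) * (φ p.2 / φ (p.1 * p.2) * φ p.1)).Finite := by
  have := hG'.1
  have hc := IsCentral.pullback S ι hS
  have hqi := isQITrivial_of_section _ hc (s.pullback ι) (hs.pullback ι)
  obtain ⟨φ, hφ⟩ := (isBoundedClass_eulerClass_iff _ hc (s.pullback ι)).1 (hG'.2 Z _ _ hc hZ hqi)
  refine ⟨φ, hφ.subset ?_⟩
  rintro _ ⟨⟨g, h⟩, rfl⟩
  exact ⟨(g, h), by simp only [sectionCochain_pullback]⟩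

/-- The Euler class is bounded as soon as it is at bounded distance from a real coboundary after
composition with any homomorphism to `ℝ`. -/
theorem isBoundedClass_eulerClass_of_real {Z E G : Type} [CommGroup Z] [Group E] [Group G]
    (S : GroupExtension Z E G) (hS : S.IsCentral) (hZ : Group.FG Z) (s : S.Section)
    (h : ∀ p : Z → ℝ, (∀ z z', p (z * z') = p z + p z') → ∃ (ψ : G → ℝ) (K : ℝ), ∀ g h,
      |p (S.sectionCochain s (g, h)) + ψ (g * h) - ψ g - ψ h| ≤ K) :
    IsBoundedClass (S.eulerClass hS) := by
  classical
  obtain ⟨n, ι, _, q, hq, r, ⟨e⟩⟩ := AddCommGroup.equiv_free_prod_directSum_zmod (Additive Z)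
  have : ∀ i, NeZero (q i ^ r i) := fun i => ⟨pow_ne_zero _ (hq i).ne_zero⟩
  have : Finite (DirectSum ι fun i => ZMod (q i ^ r i)) :=
    Finite.of_equiv _ (DirectSum.addEquivProd fun i => ZMod (q i ^ r i)).symm.toEquiv
  choose ψ K hψ using fun j => h (fun z => ((e (Additive.ofMul z)).1 j : ℝ)) fun z z' => by
    simp
  -- Round the real primitives down to integers; the torsion coordinate needs no correction, as it
  -- takes finitely many values anyway.
  refine (S.isBoundedClass_eulerClass_iff hS s).2
    ⟨fun g => Additive.toMul (e.symm (Finsupp.equivFunOnFinite.symm fun j => -⌊ψ j g⌋, 0)), ?_⟩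
  -- The `3` absorbs the three roundings, each by less than `1`.
  have hbox : (Set.univ.pi fun j => Set.Icc (-⌈K j + 3⌉) ⌈K j + 3⌉).Finite :=
    Set.Finite.pi fun j => Set.finite_Icc _ _
  refine Set.Finite.of_finite_image (f := fun z : Z =>
    (Finsupp.equivFunOnFinite (e (Additive.ofMul z)).1, (e (Additive.ofMul z)).2)) ?_ ?_
  · refine (hbox.prod (Set.finite_univ)).subset ?_
    rintro _ ⟨_, ⟨⟨g, h⟩, rfl⟩, rfl⟩
    refine ⟨fun j _ => ?_, Set.mem_univ _⟩
    have h1 := abs_le.1 (hψ j g h)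
    have h2 := Int.floor_le (ψ j g)
    have h3 := Int.lt_floor_add_one (ψ j g)
    have h4 := Int.floor_le (ψ j h)
    have h5 := Int.lt_floor_add_one (ψ j h)
    have h6 := Int.floor_le (ψ j (g * h))
    have h7 := Int.lt_floor_add_one (ψ j (g * h))
    have h8 := Int.le_ceil (K j + 3)
    simp only [ofMul_mul, ofMul_div, ofMul_toMul, map_add, map_sub, AddEquiv.apply_symm_apply,
      Prod.fst_add, Prod.fst_sub, Finsupp.equivFunOnFinite_apply, Finsupp.add_apply,
      Finsupp.sub_apply, Finsupp.equivFunOnFinite_symm_apply_apply]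
    constructor
    · rify
      linarith [h1.1, h1.2]
    · rify
      linarith [h1.1, h1.2]
  · intro z _ z' _ hz
    simp only [Prod.mk.injEq, EmbeddingLike.apply_eq_iff_eq] at hz
    exact Additive.ofMul.injective (e.injective (Prod.ext hz.1 hz.2))

end GroupExtension

/-! ### Normal forms and generation in amalgamated products. -/

namespace Monoid.PushoutI

variable {H : Type*} [Group H] {K : Bool → Type*} [∀ b, Group (K b)] {φ : ∀ b, H →* K b}
  {E : Type*} [Group E]

/-- The normal form theorem for the preimages in `E` of the factors of an amalgamated product. -/
theorem eq_nil_of_isReducedWord_comap (hφ : ∀ b, Function.Injective (φ b))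
    (π : E →* Monoid.PushoutI φ) {l : List (Bool × E)}
    (hl : IsReducedWord (fun b => (of (φ := φ) b).range.comap π) ((base φ).range.comap π) l)
    (hC : wordProd l ∈ (base φ).range.comap π) : l = [] := by
  let u : Bool × E → Σ b, K b := fun a => ⟨a.1, Function.invFun (of (φ := φ) a.1) (π a.2)⟩
  have hu : ∀ a ∈ l, of (φ := φ) (u a).1 (u a).2 = π a.2 := fun a ha =>
    Function.invFun_eq (hl.2 a ha).1
  have hbase : ∀ a ∈ l, (u a).2 ∉ (φ (u a).1).range := by
    rintro a ha ⟨h, hh⟩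
    refine (hl.2 a ha).2 ⟨h, ?_⟩
    rw [← hu a ha, ← hh, of_apply_eq_base]
  let w : Monoid.CoprodI.Word K :=
    { toList := l.map u
      ne_one := by
        intro x hx h1
        obtain ⟨a, ha, rfl⟩ := List.mem_map.1 hx
        exact hbase a ha (h1 ▸ one_mem _)
      chain_ne := by
        rw [List.isChain_map]
        exact hl.1 }
  have hw : Reduced φ w := by
    intro x hx
    obtain ⟨a, ha, rfl⟩ := List.mem_map.1 hx
    exact hbase a ha
  have hprod : ofCoprodI (φ := φ) w.prod = π (wordProd l) := by
    simp only [w, Monoid.CoprodI.Word.prod, wordProd, map_list_prod, List.map_map]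
    congr 1
    refine List.map_congr_left fun a ha => ?_
    simp only [Function.comp_apply, ofCoprodI_of]
    exact hu a ha
  have := hw.eq_empty_of_mem_range hφ (hprod ▸ hC)
  have h0 := congrArg Monoid.CoprodI.Word.toList this
  exact List.map_eq_nil_iff.1 h0

theorem iSup_comap_range_of_eq_top (π : E →* Monoid.PushoutI φ) (hπ : Function.Surjective π) :
    ⨆ b, (of (φ := φ) b).range.comap π = ⊤ := by
  refine eq_top_iff.2 fun e _ => ?_
  -- The induction runs downstairs, for all lifts at once, so that the kernel of `π` is included.
  have key : ∀ x : Monoid.PushoutI φ, ∀ e, π e = x → e ∈ ⨆ b, (of (φ := φ) b).range.comap π := by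
    intro x
    induction x using Monoid.PushoutI.induction_on with
    | of b g => exact fun e he => Subgroup.mem_iSup_of_mem b ⟨g, he.symm⟩
    | base h =>
      exact fun e he => Subgroup.mem_iSup_of_mem true
        ⟨φ true h, by rw [he, of_apply_eq_base]⟩
    | mul x y hx hy =>
      intro e he
      obtain ⟨x', hx'⟩ := hπ x
      have h1 : e = x' * (x'⁻¹ * e) := by group
      rw [h1]
      exact mul_mem (hx x' hx') (hy _ (by rw [map_mul, map_inv, he, hx', inv_mul_cancel_left]))
  exact key _ e rfl

theorem fg_of_fg (hK : ∀ b, Group.FG (K b)) : Group.FG (Monoid.PushoutI φ) := by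
  have h1 : ⨆ b, (of (φ := φ) b).range = ⊤ :=
    iSup_comap_range_of_eq_top (MonoidHom.id (Monoid.PushoutI φ)) Function.surjective_id
  rw [Group.fg_def, ← h1]
  refine Subgroup.FG.iSup _ fun b => ?_
  have := hK b
  exact (Group.fg_iff_subgroup_fg _).1 (Group.fg_range _)

end Monoid.PushoutI

/-! ### Construction of the real primitive and conclusion. -/

open Monoid.PushoutI

/-- A real-valued function of a central extension of an amalgamated product over an amenable
subgroup: the image of the cocycle of a section under a homomorphism `p` to `ℝ` is at bounded
distance from a coboundary if this holds on the two factors. -/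
theorem GroupExtension.exists_real_primitive {Z E H : Type*} [Group Z] [Group E] [Group H]
    {K : Bool → Type*} [∀ b, Group (K b)] {φ : ∀ b, H →* K b}
    (hφ : ∀ b, Function.Injective (φ b)) (hH : IsAmenableGroup H)
    (htrans : ∀ t : H → ℝ, (∀ g h, t (g * h) = t g + t h) → ∃ t' : ∀ b, K b → ℝ,
      (∀ b g h, t' b (g * h) = t' b g + t' b h) ∧
        ∀ h, t h = t' true (φ true h) - t' false (φ false h))
    (S : GroupExtension Z E (Monoid.PushoutI φ)) (hS : S.IsCentral) (s : S.Section)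
    (p : Z → ℝ) (hp : ∀ z z', p (z * z') = p z + p z') (ψ : ∀ b, K b → ℝ) (B : ℝ)
    (hψ : ∀ b g h, |p (S.sectionCochain s (of b g, of b h)) + ψ b h - ψ b (g * h) + ψ b g| ≤ B) :
    ∃ (Ψ : Monoid.PushoutI φ → ℝ) (D : ℝ), ∀ g h,
      |p (S.sectionCochain s (g, h)) + Ψ (g * h) - Ψ g - Ψ h| ≤ D := by
  obtain ⟨M, hM⟩ := hH.exists_isRightInvariantMean
  set π := S.rightHom with hπ
  let A : Bool → Subgroup E := fun b => (of (φ := φ) b).range.comap π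
  let C : Subgroup E := (base φ).range.comap π
  let N : Subgroup E := S.inl.range
  let ζ := S.fiberCoord s
  let σ : H → E := fun h => s (base φ h)
  let ρ : ∀ b, E → K b := fun b e => Function.invFun (of (φ := φ) b) (π e)
  have c := fun z e => (Subgroup.mem_center_iff.1 (hS z) e)
  have hρ : ∀ b, ∀ e ∈ A b, of b (ρ b e) = π e := fun b e he => Function.invFun_eq he
  have hρ_eq : ∀ b e g, π e = of b g → ρ b e = g := fun b e g h => by
    simp only [ρ, h]
    exact Function.leftInverse_invFun (of_injective hφ b) g
  have hρ_mul : ∀ b, ∀ x ∈ A b, ∀ y ∈ A b, ρ b (x * y) = ρ b x * ρ b y := fun b x hx y hy =>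
    hρ_eq b _ _ (by rw [map_mul, map_mul, hρ b x hx, hρ b y hy])
  have hρ_inl : ∀ b z x, ρ b (S.inl z * x) = ρ b x := fun b z x => by
    simp [ρ, hπ]
  have hζ : ∀ e, S.inl (ζ e) * s (π e) = e := S.inl_fiberCoord_mul s
  have hζ_eq : ∀ e z, S.inl z * s (π e) = e → ζ e = z := fun e z h =>
    S.inl_injective (mul_right_cancel ((hζ e).trans h.symm))
  have hζ_inl : ∀ z x, ζ (S.inl z * x) = z * ζ x := fun z x => hζ_eq _ _ (by
    rw [map_mul, map_mul, hπ, S.rightHom_inl, one_mul, mul_assoc, ← hπ, hζ])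
  have hω : ∀ g h, S.inl (S.sectionCochain s (g, h)) * s (g * h) = s g * s h := fun g h => by
    rw [S.inl_sectionCochain]
    group
  have hζ_mul : ∀ x y, ζ (x * y) = ζ x * ζ y * S.sectionCochain s (π x, π y) := fun x y =>
    hζ_eq _ _ (by
      rw [map_mul, map_mul π, mul_assoc, hω, map_mul, mul_assoc, ← mul_assoc (S.inl (ζ y)),
        ← c (ζ y), mul_assoc, hζ, ← mul_assoc, hζ])
  have hCA : ∀ b, C ≤ A b := by
    rintro b e ⟨h, hh⟩
    exact ⟨φ b h, by rw [of_apply_eq_base, hh]⟩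
  have hker : ∀ e, π e = 1 → e ∈ N := fun e he => by
    change e ∈ S.inl.range
    rwa [S.range_inl_eq_ker_rightHom, MonoidHom.mem_ker]
  have hσπ : ∀ h, π (σ h) = base φ h := fun h => by simp [σ, hπ]
  have hσ : IsCentralTransversal N C σ :=
    { le_center := by
        rintro _ ⟨z, rfl⟩
        exact hS z
      le := by
        rintro _ ⟨z, rfl⟩
        exact ⟨1, by simp [hπ]⟩
      mem := fun h => ⟨h, (hσπ h).symm⟩
      exists_mul := by
        rintro k ⟨h, hh⟩
        refine ⟨h, fun g => ⟨σ g * k * (σ (g * h))⁻¹, hker _ ?_, by group⟩⟩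
        rw [map_mul, map_mul, map_inv, hσπ, hσπ, ← hh, map_mul, mul_inv_cancel] }
  -- On `E` the cocycle becomes the coboundary of the fiber coordinate `ζ`, so the bound on each
  -- factor says exactly that `F b` is a quasimorphism on `A b`.
  let F : Bool → E → ℝ := fun b e => p (ζ e) - ψ b (ρ b e)
  have hF : ∀ b, ∀ x ∈ A b, ∀ y ∈ A b, |F b (x * y) - F b x - F b y| ≤ B := by
    intro b x hx y hy
    have h1 := hψ b (ρ b x) (ρ b y)
    simp only [F]
    rw [hζ_mul, hp, hp, hρ_mul b x hx y hy, ← hρ b x hx, ← hρ b y hy]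
    convert h1 using 2
    ring
  let q : E → ℝ := fun e => p (Function.invFun S.inl e)
  have hq : ∀ z, q (S.inl z) = p z := fun z =>
    congrArg p (Function.leftInverse_invFun S.inl_injective z)
  have hFN : ∀ b, ∀ z ∈ N, ∀ x, F b (z * x) = q z + F b x := by
    rintro b _ ⟨z, rfl⟩ x
    simp only [F]
    rw [hζ_inl, hp, hρ_inl, hq]
    ring
  choose f hf hfN hfF using fun b => hM.exists_hom_near hσ (F := F b) (p := q)
    (fun x hx y hy => hF b x (hCA b hx) y (hCA b hy)) (fun z hz x _ => hFN b z hz x)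
  -- Both `f b` restrict to `p` on the central subgroup, so their difference is a homomorphism on
  -- `H`, although `σ` is not.
  obtain ⟨t, ht, htf⟩ := htrans (fun h => f false (σ h) - f true (σ h)) (fun g h => by
    obtain ⟨z, hz, he⟩ : ∃ z ∈ N, σ g * σ h = z * σ (g * h) :=
      ⟨σ g * σ h * (σ (g * h))⁻¹, hker _ (by
        rw [map_mul, map_mul, map_inv, hσπ, hσπ, hσπ, map_mul, mul_inv_cancel]), by group⟩
    have h1 : ∀ b, f b (σ g) + f b (σ h) = q z + f b (σ (g * h)) := fun b => by
      rw [← hf b _ (hσ.mem g) _ (hσ.mem h), he, hf b _ (hσ.le hz) _ (hσ.mem _), hfN b z hz]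
    linarith [h1 true, h1 false])
  have ht1 : ∀ b, t b 1 = 0 := fun b => by
    have := ht b 1 1
    rw [mul_one] at this
    linarith
  -- The common homomorphism on `C`: once corrected by `t b`, the two `f b` agree there.
  let k : E → ℝ := fun e => f true e + t true (ρ true e)
  have hk : ∀ b, ∀ e ∈ C, k e = f b e + t b (ρ b e) := by
    intro b e he
    cases b with
    | true => rfl
    | false =>
      obtain ⟨h, hh⟩ := he
      have h1 : ∀ b, ρ b e = φ b h := fun b => hρ_eq b _ _ (by rw [of_apply_eq_base, hh])
      have h2 : e * (σ h)⁻¹ ∈ N := hker _ (by rw [map_mul, map_inv, hσπ, hh, mul_inv_cancel])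
      have h3 : ∀ b, f b e = q (e * (σ h)⁻¹) + f b (σ h) := fun b => by
        rw [← hfN b _ h2, ← hf b _ (hσ.le h2) _ (hσ.mem h), inv_mul_cancel_right]
      simp only [k]
      rw [h1, h1, h3, h3 false]
      linarith [htf h]
  have hkmul : ∀ x ∈ C, ∀ y ∈ C, k (x * y) = k x + k y := by
    intro x hx y hy
    simp only [k]
    rw [hf true x hx y hy, hρ_mul true x (hCA _ hx) y (hCA _ hy), ht]
    ring
  have hkN : ∀ z ∈ N, k z = q z := by
    intro z hz
    simp only [k]
    rw [hfN true z hz]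
    obtain ⟨z, rfl⟩ := hz
    rw [hρ_eq true _ 1 (by simp [hπ]), ht1, add_zero]
  choose F' K' hl hr hinv hnear using fun b => hM.exists_biequivariant hσ (hCA b)
    (F := fun e => F b e + t b (ρ b e)) (f := k) (D := B) (B := B) hkmul
    (fun x hx y hy => by
      have h1 := hF b x hx y hy
      rw [hρ_mul b x hx y hy, ht]
      convert h1 using 2
      ring)
    (fun x hx => by
      have h1 := hfF b x hx
      rw [hk b x hx, abs_sub_comm]
      convert h1 using 2
      ring)
    (fun z hz x hx => by
      rw [hFN b z hz, hkN z hz]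
      obtain ⟨z, rfl⟩ := hz
      rw [hρ_inl]
      ring)
  have hbi : IsBiequivariant A C F' k := ⟨hkmul, hl, hr, hinv⟩
  obtain ⟨Φ, D, hΦ, hΦF⟩ := hbi.exists_quasimorphism (D := B + 3 * max (K' false) (K' true)) hCA
    (fun b x hx y hy => by
      have hK : K' b ≤ max (K' false) (K' true) := by cases b <;> simp
      have h1 := hF b x hx y hy
      have h2 := (hnear b x hx).trans hK
      have h3 := (hnear b y hy).trans hK
      have h4 := (hnear b _ ((A b).mul_mem hx hy)).trans hK
      rw [hρ_mul b x hx y hy, ht] at h4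
      rw [abs_le] at h1 h2 h3 h4 ⊢
      constructor <;> linarith [h1.1, h1.2, h2.1, h2.2, h3.1, h3.2, h4.1, h4.2])
    (iSup_comap_range_of_eq_top π S.rightHom_surjective)
    (fun l hl hlC => eq_nil_of_isReducedWord_comap hφ π hl hlC)
  -- Apply `Φ` to `s(g) s(h) = z s(gh)`: one `D` for each of the two products, and one for comparing
  -- `Φ` with `p` at `z`.
  refine ⟨fun g => Φ (s g), 3 * D, fun g h => ?_⟩
  set z := S.sectionCochain s (g, h)
  have hz : S.inl z ∈ N := ⟨z, rfl⟩
  have h1 := hΦ (s g) (s h)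
  have h2 := hΦ (S.inl z) (s (g * h))
  have h3 := hΦF true (S.inl z) (hCA _ (hσ.le hz))
  rw [hω] at h2
  rw [hbi.eq_of_mem (hσ.le hz), hkN _ hz, hq] at h3
  rw [abs_le] at h1 h2 h3 ⊢
  constructor <;> linarith [h1.1, h1.2, h2.1, h2.2, h3.1, h3.2]

theorem proposition5 (H G₁ G₂ : Type) [Group H] [Group G₁] [Group G₂]
    (i₁ : H →* G₁) (i₂ : H →* G₂)
    (hi₁ : Function.Injective i₁) (hi₂ : Function.Injective i₂)
    (hH : IsAmenableGroup H) (htrans : IsTransverse i₁ i₂)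
    (hG₁ : PropertyQITB G₁) (hG₂ : PropertyQITB G₂) :
    PropertyQITB (AmalgamatedProduct i₁ i₂) := by
  have hK : ∀ b, PropertyQITB (amalgamFactor G₁ G₂ b) := fun b => by
    cases b
    exacts [hG₁, hG₂]
  have hinj : ∀ b, Function.Injective (amalgamHom i₁ i₂ b) := fun b => by
    cases b
    exacts [hi₁, hi₂]
  refine ⟨fg_of_fg fun b => (hK b).1, fun Z E _ _ S hS hZ hqi => ?_⟩
  obtain ⟨s, hs⟩ := hqi.exists_section
  choose η hη using fun b =>
    S.exists_finite_range_of_propertyQITB hS hZ s hs (of (φ := amalgamHom i₁ i₂) b) (hK b)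
  refine S.isBoundedClass_eulerClass_of_real hS hZ s fun p hp => ?_
  have hpdiv : ∀ z z', p (z / z') = p z - p z' := fun z z' => by
    have := hp (z / z') z'
    rw [div_mul_cancel] at this
    linarith
  choose B hB using fun b => ((hη b).range_comp_fun fun z => |p z|).bddAbove
  refine GroupExtension.exists_real_primitive hinj hH (fun t ht => ?_) S hS s p hp
    (fun b g => p (η b g)) (max (B false) (B true)) (fun b g h => ?_)
  · obtain ⟨t₁, t₂, h₁, h₂, ht'⟩ := htrans.exists_eq_add t ht
    -- Transversality yields a sum, while a difference is required; hence the sign on the first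
    -- factor.
    refine ⟨fun b => match b with
      | false => fun g : G₁ => -t₁ g
      | true => fun g : G₂ => t₂ g, fun b => ?_, fun h => ?_⟩
    · cases b with
      | false => exact fun g h : G₁ => (congrArg (- ·) (h₁ g h)).trans (by ring)
      | true => exact h₂
    · refine (ht' h).trans ?_
      change t₁ (i₁ h) + t₂ (i₂ h) = t₂ (i₂ h) - -t₁ (i₁ h)
      ring
  · have h1 := hB b ⟨(g, h), rfl⟩
    have h2 : B b ≤ max (B false) (B true) := by cases b <;> simp
    simp only [hp, hpdiv] at h1
    refine (le_of_eq ?_).trans (h1.trans h2)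
    congr 1
    ring
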